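/- Let $\mathcal G$ be the set of isomorphism classes of finite abelian groups, let $\mathcal G_P$ be the set of all integer partitions (including the empty one), and let $\mathbb P$ be the set of primes. For $p\in\mathbb P$ and $\lambda\in\mathcal G_P$ let $A_{p,\lambda}=\prod_{e}\mathbb Z/p^{e}$, where $e$ runs over the parts of $\lambda$ with multiplicity; for $G\in\mathcal G$ let $\lambda_p(G)\in\mathcal G_P$ be the unique partition such that the $p$-part of $G$ is isomorphic to $A_{p,\lambda_p(G)}$. The local Cohen--Lenstra probability $P_p$ on $\mathcal G_P$ is $P_p(S)=w_p(S)/w_p(\mathcal G_P)$, where $w_p(S)=\sum_{\lambda\in S}\frac1{\#\mathrm{Aut}(A_{p,\lambda})}$ for $S\subseteq\mathcal G_P$. A property $E:\mathcal G\to\{0,1\}$ is called uniform if there is a function $E_{\mathcal G_P}:\mathcal G_P\to\{0,1\}$ such that for all $G\in\mathcal G$: $E(G)=1$ if and only if $E_{\mathcal G_P}(\lambda_p(G))=1$ for all $p\in\mathbb P$; we then say that $E_{\mathcal G_P}$ defines $E$. Put $O(E)=\{G\in\mathcal G: E(G)=1\}$, and let $\Sigma_{\mathcal G}$ be the $\sigma$-algebra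 on $\mathcal G$ generated by the sets $O(E)$ of all uniform properties $E$. Theorem. Every uniform property is measurable with respect to $\Sigma_{\mathcal G}$, and there is exactly one probability measure $P_{\mathcal G}$ on $(\mathcal G,\Sigma_{\mathcal G})$ such that $$P_{\mathcal G}(O(E))=\prod_{p\in\mathbb P}P_p\bigl(E_{\mathcal G_P}^{-1}(\{1\})\bigr)$$ for every uniform property $E$ and every function $E_{\mathcal G_P}$ that defines it. Here the infinite product is the (unconditional) limit of its finite partial products, which may be $0$. -/

import Mathlib

open MeasureTheory
open scoped ENNReal

/-- The set `𝒢_P` of all integer partitions (of all natural numbers, including the empty partition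
of `0`). -/
abbrev IntPartition : Type := Σ n : ℕ, Nat.Partition n

/-- The finite abelian `p`-group `∏ ZMod (p ^ e)` attached to a partition, where `e` runs over the
parts of the partition, with multiplicity. -/
abbrev PartitionGroup (p : ℕ) (l : IntPartition) : Type :=
  (i : l.2.parts) → ZMod (p ^ (i : ℕ))

/-- A finite abelian group. -/
structure FinAbGroup : Type 1 where
  carrier : Type
  [grp : AddCommGroup carrier]
  [fin : Finite carrier]

attribute [instance] FinAbGroup.grp FinAbGroup.fin

/-- Two finite abelian groups are equivalent if they are isomorphic. -/
instance FinAbGroup.isoSetoid : Setoid FinAbGroup where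
  r A B := Nonempty (A.carrier ≃+ B.carrier)
  iseqv :=
    ⟨fun A => ⟨AddEquiv.refl A.carrier⟩, fun ⟨f⟩ => ⟨f.symm⟩, fun ⟨f⟩ ⟨g⟩ => ⟨f.trans g⟩⟩

/-- The set `𝒢` of isomorphism classes of finite abelian groups. -/
def IsoClass : Type 1 := Quotient FinAbGroup.isoSetoid

/-- The isomorphism class of a finite abelian group. -/
def IsoClass.mk (A : FinAbGroup) : IsoClass := Quotient.mk FinAbGroup.isoSetoid A

/-- The partition `l` describes the `p`-part (`p`-primary component) of `A`. -/
def IsPPart (p : Nat.Primes) (A : FinAbGroup) (l : IntPartition) : Prop :=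
  Nonempty (AddCommGroup.primaryComponent A.carrier (p : ℕ) ≃+ PartitionGroup p l)

theorem IsPPart.exists (p : Nat.Primes) (A : FinAbGroup) : ∃ l, IsPPart p A l := by
  classical
  haveI : Fact (Nat.Prime (p : ℕ)) := ⟨p.2⟩
  set H := AddCommGroup.primaryComponent A.carrier (p : ℕ) with hH
  obtain ⟨ι, _, n, hn, ⟨f⟩⟩ := AddCommGroup.equiv_directSum_zmod_of_finite' H
  let f' : H ≃+ ((i : ι) → ZMod (n i)) := f.trans (DirectSum.addEquivProd _)
  have hpow : ∀ i, ∃ k, n i = (p : ℕ) ^ k := by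
    intro i
    obtain ⟨k, hk⟩ := (f'.symm (Pi.single i 1)).2
    have h0 : (p : ℕ) ^ k • f'.symm (Pi.single i 1) = 0 := Subtype.ext hk
    have h1 : (p : ℕ) ^ k • (Pi.single i 1 : (i : ι) → ZMod (n i)) = 0 := by
      have := congrArg f' h0
      simpa only [map_nsmul, AddEquiv.apply_symm_apply, map_zero] using this
    have h2 : (((p : ℕ) ^ k : ℕ) : ZMod (n i)) = 0 := by
      have := congrFun h1 i
      simpa [nsmul_eq_mul] using this
    rw [ZMod.natCast_eq_zero_iff] at h2
    obtain ⟨m, -, hm⟩ := (Nat.dvd_prime_pow p.2).1 h2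
    exact ⟨m, hm⟩
  choose e he using hpow
  have hpos : ∀ i, 0 < e i := by
    intro i
    rcases Nat.eq_zero_or_pos (e i) with h | h
    · have h1 := hn i
      rw [he i, h, pow_zero] at h1
      exact absurd h1 (lt_irrefl 1)
    · exact h
  let M : Multiset ℕ := (Finset.univ : Finset ι).val.map e
  let l : IntPartition := ⟨M.sum, ⟨M, by
    intro i hi
    obtain ⟨j, -, rfl⟩ := Multiset.mem_map.1 hi
    exact hpos j, rfl⟩⟩
  have hinj : Function.Injective
      (fun x : (Finset.univ : Finset ι).val => (x : ι)) := by
    rintro ⟨a, i⟩ ⟨b, j⟩ h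
    obtain rfl : a = b := h
    have h1 : Multiset.count a (Finset.univ : Finset ι).val ≤ 1 :=
      Multiset.nodup_iff_count_le_one.1 Finset.univ.nodup a
    have : i = j := by
      apply Fin.ext
      have := i.2
      have := j.2
      omega
    rw [this]
  have hsurj : Function.Surjective
      (fun x : (Finset.univ : Finset ι).val => (x : ι)) := by
    intro a
    exact ⟨⟨a, ⟨0, Multiset.count_pos.2 (Finset.mem_univ a)⟩⟩, rfl⟩
  let g₀ : (Finset.univ : Finset ι).val ≃ ι := Equiv.ofBijective _ ⟨hinj, hsurj⟩
  let g : M ≃ ι := (Multiset.mapEquiv _ e).symm.trans g₀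
  have hg : ∀ x : M, n (g x) = (p : ℕ) ^ (x : ℕ) := by
    intro x
    rw [he]
    congr 1
    have := Multiset.mapEquiv_apply (Finset.univ : Finset ι).val e
      ((Multiset.mapEquiv _ e).symm x)
    rw [Equiv.apply_symm_apply] at this
    exact this.symm
  refine ⟨l, ⟨f'.trans ?_⟩⟩
  exact (RingEquiv.piCongrLeft (fun i => ZMod (n i)) g).symm.toAddEquiv.trans
    (AddEquiv.piCongrRight fun x : M => (ZMod.ringEquivCongr (hg x)).toAddEquiv)

/-- A partition is determined by the numbers `∑ min e k`, where `e` runs over its parts. -/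
theorem IntPartition.ext_of_sum_min (l m : IntPartition)
    (h : ∀ k : ℕ, (l.2.parts.map fun e => min e k).sum = (m.2.parts.map fun e => min e k).sum) :
    l = m := by
  have key : ∀ (k : ℕ) (s : Multiset ℕ), 2 * (s.map fun e => min e (k + 1)).sum =
      (s.map fun e => min e k).sum + (s.map fun e => min e (k + 2)).sum + s.count (k + 1) := by
    intro k s
    induction s using Multiset.induction_on with
    | empty => simp
    | cons a s ih =>
      simp only [Multiset.map_cons, Multiset.sum_cons, Multiset.count_cons]
      split_ifs with hk <;> omega
  have hparts : l.2.parts = m.2.parts := by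
    ext k
    rcases k with _ | k
    · rw [Multiset.count_eq_zero_of_notMem fun h0 => lt_irrefl 0 (l.2.parts_pos h0),
        Multiset.count_eq_zero_of_notMem fun h0 => lt_irrefl 0 (m.2.parts_pos h0)]
    · have h1 := key k l.2.parts
      have h2 := key k m.2.parts
      rw [h, h, h] at h1
      omega
  obtain ⟨a, l⟩ := l
  obtain ⟨b, m⟩ := m
  obtain rfl : a = b := by
    rw [← l.parts_sum, ← m.parts_sum]
    exact congrArg Multiset.sum hparts
  have : l = m := Nat.Partition.ext hparts
  rw [this]

/-- The number of elements of `PartitionGroup p l` that are killed by `p ^ k`. -/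
theorem PartitionGroup.card_torsion (p : Nat.Primes) (l : IntPartition) (k : ℕ) :
    Nat.card {x : PartitionGroup p l // (p : ℕ) ^ k • x = 0} =
      (p : ℕ) ^ (l.2.parts.map fun e => min e k).sum := by
  classical
  have hcyc : ∀ e : ℕ, Nat.card {y : ZMod ((p : ℕ) ^ e) // (p : ℕ) ^ k • y = 0} =
      (p : ℕ) ^ min e k := by
    intro e
    haveI : NeZero ((p : ℕ) ^ e) := ⟨pow_ne_zero _ p.2.ne_zero⟩
    have h := IsAddCyclic.card_nsmulAddMonoidHom_ker (G := ZMod ((p : ℕ) ^ e)) ((p : ℕ) ^ k)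
    rw [Nat.card_zmod] at h
    have h2 : Nat.gcd ((p : ℕ) ^ e) ((p : ℕ) ^ k) = (p : ℕ) ^ min e k := by
      rcases le_total e k with hek | hek
      · rw [min_eq_left hek]
        exact Nat.gcd_eq_left (pow_dvd_pow _ hek)
      · rw [min_eq_right hek]
        exact Nat.gcd_eq_right (pow_dvd_pow _ hek)
    rw [h2] at h
    exact h
  have e1 : {x : PartitionGroup p l // (p : ℕ) ^ k • x = 0} ≃
      ((i : l.2.parts) → {y : ZMod ((p : ℕ) ^ (i : ℕ)) // (p : ℕ) ^ k • y = 0}) :=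
    { toFun := fun x i => ⟨x.1 i, congrFun x.2 i⟩
      invFun := fun y => ⟨fun i => (y i).1, funext fun i => (y i).2⟩
      left_inv := fun _ => rfl
      right_inv := fun _ => rfl }
  rw [Nat.card_congr e1, Nat.card_pi]
  simp only [hcyc]
  rw [Finset.prod_pow_eq_pow_sum]
  congr 1
  conv_rhs => rw [← Multiset.map_univ_coe l.2.parts]
  rw [Multiset.map_map]
  rfl

theorem IsPPart.unique {p : Nat.Primes} {A B : FinAbGroup} {l m : IntPartition}
    (hl : IsPPart p A l) (hm : IsPPart p B m) (h : IsoClass.mk A = IsoClass.mk B) : l = m := by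
  obtain ⟨f⟩ := hl
  obtain ⟨g⟩ := hm
  obtain ⟨φ⟩ : Nonempty (A.carrier ≃+ B.carrier) := Quotient.exact h
  let ψ : AddCommGroup.primaryComponent A.carrier (p : ℕ) ≃+
      AddCommGroup.primaryComponent B.carrier (p : ℕ) :=
    { toFun := fun x => ⟨φ x.1, by
        obtain ⟨k, hk⟩ := x.2
        exact ⟨k, by rw [← map_nsmul, hk, map_zero]⟩⟩
      invFun := fun x => ⟨φ.symm x.1, by
        obtain ⟨k, hk⟩ := x.2
        exact ⟨k, by rw [← map_nsmul, hk, map_zero]⟩⟩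
      left_inv := fun x => Subtype.ext (φ.symm_apply_apply _)
      right_inv := fun x => Subtype.ext (φ.apply_symm_apply _)
      map_add' := fun x y => Subtype.ext (map_add φ _ _) }
  let χ : PartitionGroup p l ≃+ PartitionGroup p m := f.symm.trans (ψ.trans g)
  refine IntPartition.ext_of_sum_min l m fun k => ?_
  have e : {x : PartitionGroup p l // (p : ℕ) ^ k • x = 0} ≃
      {x : PartitionGroup p m // (p : ℕ) ^ k • x = 0} :=
    χ.toEquiv.subtypeEquiv fun x => by
      change _ ↔ (p : ℕ) ^ k • χ x = 0
      rw [← map_nsmul, map_eq_zero_iff χ χ.injective]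
  have hc := Nat.card_congr e
  rw [PartitionGroup.card_torsion, PartitionGroup.card_torsion] at hc
  exact Nat.pow_right_injective p.2.two_le hc

theorem IsoClass.existsUnique_pPart (p : Nat.Primes) (G : IsoClass) :
    ∃! l : IntPartition, ∃ A : FinAbGroup, IsoClass.mk A = G ∧ IsPPart p A l := by
  obtain ⟨A, rfl⟩ : ∃ A, IsoClass.mk A = G := Quotient.exists_rep G
  obtain ⟨l, hl⟩ := IsPPart.exists p A
  refine ⟨l, ⟨A, rfl, hl⟩, ?_⟩
  rintro m ⟨B, hB, hm⟩
  exact hm.unique hl hB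

/-- The partition corresponding to the `p`-part of `G`. -/
noncomputable def IsoClass.pPart (p : Nat.Primes) (G : IsoClass) : IntPartition :=
  (IsoClass.existsUnique_pPart p G).choose

/-- `G.pPart p` is the one and only partition that describes the `p`-part of `G`. -/
theorem IsoClass.pPart_mk_eq_iff (p : Nat.Primes) (A : FinAbGroup) (l : IntPartition) :
    (IsoClass.mk A).pPart p = l ↔
      Nonempty (AddCommGroup.primaryComponent A.carrier (p : ℕ) ≃+ PartitionGroup p l) := by
  have h := (IsoClass.existsUnique_pPart p (IsoClass.mk A)).choose_spec
  constructor
  · rintro rfl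
    obtain ⟨l, hl⟩ := IsPPart.exists p A
    have := h.2 l ⟨A, rfl, hl⟩
    rw [this] at hl
    exact hl
  · intro hl
    exact (h.2 l ⟨A, rfl, hl⟩).symm

/-- All sets of partitions are measurable. -/
instance IntPartition.measurableSpace : MeasurableSpace IntPartition := ⊤

/-- The local Cohen–Lenstra weight `w_p`, transported to the set of partitions: the measure that
gives mass `1 / #Aut` to every (isomorphism class of) finite abelian `p`-group. -/
noncomputable def localWeight (p : Nat.Primes) : Measure IntPartition :=
  Measure.sum fun l : IntPartition =>
    ((Nat.card (AddAut (PartitionGroup p l)) : ℝ≥0∞))⁻¹ • Measure.dirac l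

/-- The local Cohen–Lenstra probability `P_p = w_p / w_p(𝒢_p)` on the set of partitions. -/
noncomputable def localProb (p : Nat.Primes) : Measure IntPartition :=
  (localWeight p Set.univ)⁻¹ • localWeight p

/-- The property `E` of finite abelian groups is given by the property `e` of partitions: a group
has `E` if and only if all its `p`-parts have `e`. -/
def IsGivenBy (E : IsoClass → Prop) (e : IntPartition → Prop) : Prop :=
  ∀ G : IsoClass, E G ↔ ∀ p : Nat.Primes, e (G.pPart p)

/-- Uniform properties of finite abelian groups. -/
def IsUniform (E : IsoClass → Prop) : Prop :=
  ∃ e : IntPartition → Prop, IsGivenBy E e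

/-- The `σ`-algebra `Σ_𝒢` generated by the sets `O(E) = {G | E G}` of all uniform properties. -/
instance IsoClass.measurableSpace : MeasurableSpace IsoClass :=
  MeasurableSpace.generateFrom {S | ∃ E : IsoClass → Prop, IsUniform E ∧ S = {G | E G}}

/-! Uniqueness is soft: the sets `O(E)` form a π-system generating the σ-algebra. For existence,
draw independent partitions `ω p` with laws `P_p`. Such a family is in general not finitely
supported, so no group need have it as its family of `p`-parts. But a uniform property sees only the
set of `p`-parts of a group, and any finite set of partitions containing the empty one is such a set
(`IsoClass.exists_range_pPart_eq`). The values of `ω` almost surely form such a set, so sending `ω`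
to a group with these values and pushing the product measure forward gives the measure sought.

The almost sure statements rest on two bounds uniform in `p`: `P_p` of size at least 2 is `O(p⁻²)`,
and the empty partition has probability bounded below. Both follow from `#Aut ≥ p ^ n / 2` and a
bound `c ^ n`, with `c < 2`, on the number of partitions of `n`. -/

/-! ### Counting partitions -/

/-- The number of partitions of `n` satisfies the Fibonacci inequality. -/
theorem Nat.Partition.card_add_two_le (n : ℕ) :
    Fintype.card (Nat.Partition (n + 2)) ≤
      Fintype.card (Nat.Partition (n + 1)) + Fintype.card (Nat.Partition n) := by
  classical
  have hex : ∀ s : Nat.Partition (n + 2), ∃ k, k ∈ s.parts := by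
    intro s
    refine Multiset.exists_mem_of_ne_zero fun h => ?_
    have := s.parts_sum
    simp [h] at this
  choose k hk using hex
  have hk2 : ∀ s : Nat.Partition (n + 2), 1 ∉ s.parts → 2 ≤ k s := by
    intro s hs
    have h0 := s.parts_pos (hk s)
    have h1 : k s ≠ 1 := fun h => hs (h ▸ hk s)
    omega
  -- Remove a part 1 if there is one; otherwise trade a part `k ≥ 2` for `k - 2` ones. In the second
  -- case the number of ones in the image recovers `k`.
  let F : Nat.Partition (n + 2) → Nat.Partition (n + 1) ⊕ Nat.Partition n := fun s =>
    if h : 1 ∈ s.parts then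
      Sum.inl ⟨s.parts.erase 1, fun hi => s.parts_pos (Multiset.mem_of_mem_erase hi), by
        have := Multiset.sum_erase h
        have := s.parts_sum
        omega⟩
    else
      Sum.inr ⟨s.parts.erase (k s) + Multiset.replicate (k s - 2) 1, by
        intro i hi
        rcases Multiset.mem_add.1 hi with hi | hi
        · exact s.parts_pos (Multiset.mem_of_mem_erase hi)
        · rw [Multiset.eq_of_mem_replicate hi]; exact one_pos, by
        have := Multiset.sum_erase (hk s)
        have := s.parts_sum
        have := hk2 s h
        simp only [Multiset.sum_add, Multiset.sum_replicate, smul_eq_mul, mul_one]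
        omega⟩
  have hF : Function.Injective F := by
    intro s t hst
    simp only [F] at hst
    split_ifs at hst with hs ht ht
    · have h := congrArg Nat.Partition.parts (Sum.inl.inj hst)
      refine Nat.Partition.ext ?_
      rw [← Multiset.cons_erase hs, ← Multiset.cons_erase ht]
      exact congrArg _ h
    · have h : s.parts.erase (k s) + Multiset.replicate (k s - 2) 1 =
          t.parts.erase (k t) + Multiset.replicate (k t - 2) 1 :=
        congrArg Nat.Partition.parts (Sum.inr.inj hst)
      have hc := congrArg (Multiset.count 1) h
      have hs0 : (s.parts.erase (k s)).count 1 = 0 :=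
        Multiset.count_eq_zero.2 fun h => hs (Multiset.mem_of_mem_erase h)
      have ht0 : (t.parts.erase (k t)).count 1 = 0 :=
        Multiset.count_eq_zero.2 fun h => ht (Multiset.mem_of_mem_erase h)
      rw [Multiset.count_add, Multiset.count_add, hs0, ht0, Multiset.count_replicate_self,
        Multiset.count_replicate_self] at hc
      have hkk : k s = k t := by
        have := hk2 s hs
        have := hk2 t ht
        omega
      rw [hkk] at h
      have h := add_right_cancel h
      refine Nat.Partition.ext ?_
      rw [← Multiset.cons_erase (hk s), ← Multiset.cons_erase (hk t), hkk, h]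
  simpa using Fintype.card_le_of_injective F hF

/-- The base 7/4 lies above the golden ratio, so the Fibonacci inequality propagates it, and below
2, so the bound still beats `2 ^ (-n)`. -/
theorem Nat.Partition.card_le_pow (n : ℕ) :
    (Fintype.card (Nat.Partition n) : ℝ) ≤ (7 / 4) ^ n := by
  induction n using Nat.strong_induction_on with
  | _ n ih =>
    rcases n with _ | _ | n
    · simp
    · simp; norm_num
    · have h : (Fintype.card (Nat.Partition (n + 2)) : ℝ) ≤
          Fintype.card (Nat.Partition (n + 1)) + Fintype.card (Nat.Partition n) := by
        exact_mod_cast Nat.Partition.card_add_two_le n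
      have h1 := ih (n + 1) (by omega)
      have h2 := ih n (by omega)
      have h3 : (0 : ℝ) ≤ (7 / 4) ^ n := by positivity
      rw [pow_succ] at h1
      rw [show n + 1 + 1 = n + 2 from rfl, pow_add]
      nlinarith

/-- The sum of `2 ^ (-n)` over all partitions of all natural numbers `n` is finite. -/
theorem IntPartition.tsum_two_inv_pow_ne_top :
    ∑' l : IntPartition, (2⁻¹ : ℝ≥0∞) ^ l.1 ≠ ∞ := by
  rw [ENNReal.tsum_sigma']
  have h : ∀ n : ℕ, ∑' _ : Nat.Partition n, (2⁻¹ : ℝ≥0∞) ^ n ≤ ENNReal.ofReal ((7 / 8) ^ n) := by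
    intro n
    rw [tsum_fintype, Finset.sum_const, Finset.card_univ, nsmul_eq_mul]
    have h2 : (2⁻¹ : ℝ≥0∞) = ENNReal.ofReal 2⁻¹ := by
      rw [ENNReal.ofReal_inv_of_pos two_pos]; simp
    rw [h2, ← ENNReal.ofReal_pow (by norm_num), ← ENNReal.ofReal_natCast,
      ← ENNReal.ofReal_mul (by positivity)]
    refine ENNReal.ofReal_le_ofReal ?_
    calc (Fintype.card (Nat.Partition n) : ℝ) * 2⁻¹ ^ n
        ≤ (7 / 4) ^ n * 2⁻¹ ^ n := by gcongr; exact Nat.Partition.card_le_pow n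
      _ = (7 / 8) ^ n := by rw [← mul_pow]; norm_num
  refine ne_top_of_le_ne_top ?_ (ENNReal.tsum_le_tsum h)
  exact (summable_geometric_of_lt_one (by norm_num) (by norm_num)).tsum_ofReal_ne_top

/-! ### Automorphisms of finite abelian p-groups -/

/-- A nontrivial finite abelian `p`-group has at least half as many automorphisms as elements. -/
theorem PartitionGroup.card_le_two_mul_card_addAut (p : Nat.Primes) (l : IntPartition) :
    (p : ℕ) ^ l.1 ≤ 2 * Nat.card (AddAut (PartitionGroup p l)) := by
  classical
  have hne : ∀ e : ℕ, NeZero ((p : ℕ) ^ e) := fun e => ⟨pow_ne_zero _ p.2.ne_zero⟩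
  have hfin : Finite (PartitionGroup p l) := inferInstance
  have hfinA : Finite (AddAut (PartitionGroup p l)) :=
    Finite.of_injective (fun f : AddAut (PartitionGroup p l) => (f : PartitionGroup p l → _))
      DFunLike.coe_injective
  have hcard : Nat.card (PartitionGroup p l) = (p : ℕ) ^ l.1 := by
    rw [Nat.card_pi]
    simp only [Nat.card_zmod]
    rw [Finset.prod_pow_eq_pow_sum]
    congr 1
    conv_rhs => rw [← l.2.parts_sum, ← Multiset.map_univ_coe l.2.parts]
    rfl
  rw [← hcard]
  rcases isEmpty_or_nonempty l.2.parts with he | he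
  · have : Nat.card (PartitionGroup p l) = 1 := Nat.card_unique
    have h2 : 0 < Nat.card (AddAut (PartitionGroup p l)) := Nat.card_pos
    omega
  -- Choosing a cyclic factor of maximal order lets its generator be sent to any element of the
  -- group.
  obtain ⟨i, hi⟩ := Finite.exists_max (fun i : l.2.parts => (i : ℕ))
  let c : (j : l.2.parts) → ZMod ((p : ℕ) ^ (i : ℕ)) →+* ZMod ((p : ℕ) ^ (j : ℕ)) := fun j =>
    ZMod.castHom (pow_dvd_pow _ (hi j)) _
  have hci : c i = RingHom.id _ := Subsingleton.elim _ _
  clear_value c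
  -- Fixes the other generators and sends the `i`-th one to `x`; it is injective because `x i` is a
  -- unit.
  let φ : {x : PartitionGroup p l // IsUnit (x i)} → PartitionGroup p l →+ PartitionGroup p l :=
    fun x =>
    { toFun := fun a j => Function.update a i 0 j + c j (a i) * x.1 j
      map_zero' := by
        funext j
        rw [Pi.zero_apply, Pi.zero_apply, map_zero, zero_mul, add_zero]
        rcases eq_or_ne j i with rfl | hj
        · rw [Function.update_self]
        · rw [Function.update_of_ne hj, Pi.zero_apply]
      map_add' := by
        intro a b
        funext j
        rw [Pi.add_apply, Pi.add_apply, map_add]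
        rcases eq_or_ne j i with rfl | hj
        · simp only [Function.update_self]
          ring
        · simp only [Function.update_of_ne hj, Pi.add_apply]
          ring }
  have hφ : ∀ x a j, φ x a j = Function.update a i 0 j + c j (a i) * x.1 j := fun _ _ _ => rfl
  have hinj : ∀ x, Function.Injective (φ x) := by
    intro x
    rw [injective_iff_map_eq_zero]
    intro a ha
    have h0 : a i = 0 := by
      have := congrFun ha i
      rw [hφ, Function.update_self, zero_add, hci, Pi.zero_apply, x.2.mul_left_eq_zero] at this
      exact this
    funext j
    rcases eq_or_ne j i with rfl | hj
    · exact h0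
    · have := congrFun ha j
      rw [hφ, h0, Function.update_of_ne hj, map_zero, zero_mul, add_zero] at this
      exact this
  let ψ : {x : PartitionGroup p l // IsUnit (x i)} → AddAut (PartitionGroup p l) := fun x =>
    AddEquiv.ofBijective (φ x) (Finite.injective_iff_bijective.1 (hinj x))
  have hψ : Function.Injective ψ := by
    intro x y hxy
    have h : φ x (Pi.single i 1) = φ y (Pi.single i 1) :=
      congrArg (fun f : AddAut (PartitionGroup p l) => f (Pi.single i 1)) hxy
    refine Subtype.ext (funext fun j => ?_)
    have := congrFun h j
    rw [hφ, hφ, Pi.single_eq_same, map_one, one_mul, one_mul] at this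
    exact add_left_cancel this
  have hnil : ∀ y : ZMod ((p : ℕ) ^ (i : ℕ)), ¬ IsUnit y → IsUnit (y + 1) := by
    intro y hy
    refine IsNilpotent.isUnit_add_one ⟨(i : ℕ), ?_⟩
    obtain ⟨m, rfl⟩ := ZMod.natCast_zmod_surjective y
    rw [ZMod.isUnit_iff_coprime] at hy
    have hpm : (p : ℕ) ∣ m := by
      by_contra hpm
      exact hy (((Nat.Prime.coprime_iff_not_dvd p.2).2 hpm).symm.pow_right _)
    rw [← Nat.cast_pow, ZMod.natCast_eq_zero_iff]
    exact pow_dvd_pow_of_dvd hpm _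
  -- Non-units of `ZMod (p ^ i)` are nilpotent, so adding 1 makes them units: at least half of all
  -- `x` are admissible.
  let θ : {x : PartitionGroup p l // ¬ IsUnit (x i)} → {x : PartitionGroup p l // IsUnit (x i)} :=
    fun x => ⟨x.1 + Pi.single i 1, by
      rw [Pi.add_apply, Pi.single_eq_same]
      exact hnil _ x.2⟩
  have hθ : Function.Injective θ := by
    intro x y hxy
    exact Subtype.ext (add_right_cancel (congrArg Subtype.val hxy))
  have h1 := Nat.card_le_card_of_injective ψ hψ
  have h2 := Nat.card_le_card_of_injective θ hθ
  have h3 : Nat.card (PartitionGroup p l) = Nat.card {x : PartitionGroup p l // IsUnit (x i)} +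
      Nat.card {x : PartitionGroup p l // ¬ IsUnit (x i)} := by
    rw [← Nat.card_sum]
    exact Nat.card_congr (Equiv.sumCompl _).symm
  omega

/-! ### Groups with prescribed p-parts -/

/-- Every finitely supported family of partitions is the family of `p`-parts of a finite abelian
group. -/
theorem IsoClass.exists_pPart_eq (f : Nat.Primes → IntPartition)
    (hf : {p | f p ≠ ⟨0, default⟩}.Finite) : ∃ G : IsoClass, ∀ p, G.pPart p = f p := by
  classical
  have hne : ∀ (p : Nat.Primes) (e : ℕ), NeZero ((p : ℕ) ^ e) :=
    fun p e => ⟨pow_ne_zero _ p.2.ne_zero⟩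
  have hsub : ∀ p, f p = ⟨0, default⟩ → Subsingleton (PartitionGroup p (f p)) := by
    intro p hp
    rw [hp]
    have : IsEmpty (Multiset.ToType (default : Nat.Partition 0).parts) := by
      rw [← Fintype.card_eq_zero_iff, Multiset.card_coe]
      simp
    infer_instance
  have hfin : Finite ((p : Nat.Primes) → PartitionGroup p (f p)) := by
    have := hf.to_subtype
    refine Finite.of_injective
      (fun (x : (p : Nat.Primes) → PartitionGroup p (f p)) (p : {p | f p ≠ ⟨0, default⟩}) => x p) ?_
    intro x y hxy
    funext p
    by_cases hp : f p = ⟨0, default⟩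
    · have := hsub p hp
      exact Subsingleton.elim _ _
    · exact congrFun hxy ⟨p, hp⟩
  have hkill : ∀ (p : Nat.Primes) (x : PartitionGroup p (f p)), ∃ k : ℕ, (p : ℕ) ^ k • x = 0 := by
    intro p x
    refine ⟨(f p).1, funext fun j => ?_⟩
    have hj : (j : ℕ) ≤ (f p).1 := Multiset.le_sum_of_mem (Multiset.coe_mem (x := j)) |>.trans_eq
      (f p).2.parts_sum
    rw [Pi.smul_apply, nsmul_eq_mul, (ZMod.natCast_eq_zero_iff _ _).2 (pow_dvd_pow _ hj), zero_mul]
    rfl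
  refine ⟨IsoClass.mk ⟨(p : Nat.Primes) → PartitionGroup p (f p)⟩, fun q => ?_⟩
  rw [IsoClass.pPart_mk_eq_iff]
  refine ⟨AddEquiv.ofBijective (AddMonoidHom.mk' (fun x => x.1 q) fun _ _ => rfl) ⟨?_, ?_⟩⟩
  · rw [injective_iff_map_eq_zero]
    rintro ⟨x, k, hk⟩ hx
    refine Subtype.ext (funext fun p => ?_)
    rcases eq_or_ne p q with rfl | hpq
    · exact hx
    · obtain ⟨m, hm⟩ := hkill p (x p)
      have hcop : Nat.Coprime ((p : ℕ) ^ m) ((q : ℕ) ^ k) :=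
        Nat.Coprime.pow _ _ ((Nat.coprime_primes p.2 q.2).2 fun h => hpq (Subtype.ext h))
      have h1 : addOrderOf (x p) ∣ (p : ℕ) ^ m := addOrderOf_dvd_of_nsmul_eq_zero hm
      have h2 : addOrderOf (x p) ∣ (q : ℕ) ^ k :=
        addOrderOf_dvd_of_nsmul_eq_zero (congrFun hk p)
      exact AddMonoid.addOrderOf_eq_one_iff.1 (Nat.eq_one_of_dvd_coprimes hcop h1 h2)
  · intro y
    obtain ⟨k, hk⟩ := hkill q y
    exact ⟨⟨Pi.single q y, k, by rw [← Pi.single_smul, hk, Pi.single_zero]⟩, by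
      exact Pi.single_eq_same (M := fun p : Nat.Primes => PartitionGroup p (f p)) q y⟩

/-- Every finite set of partitions that contains the empty one is the set of `p`-parts of a finite
abelian group. -/
theorem IsoClass.exists_range_pPart_eq {T : Set IntPartition} (hT : T.Finite)
    (h0 : ⟨0, default⟩ ∈ T) : ∃ G : IsoClass, Set.range (fun p => G.pPart p) = T := by
  classical
  have := hT.to_subtype
  obtain ⟨n, ⟨g⟩⟩ := Finite.exists_equiv_fin T
  have : Infinite Nat.Primes := Nat.Primes.infinite
  -- Assign distinct primes to the elements of `T`; every other prime gets the empty partition,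
  -- which is harmless by `h0`.
  let h : T → Nat.Primes := fun t => Infinite.natEmbedding Nat.Primes (g t)
  have hh : Function.Injective h :=
    (Infinite.natEmbedding Nat.Primes).injective.comp (Fin.val_injective.comp g.injective)
  let f : Nat.Primes → IntPartition := Function.extend h Subtype.val fun _ => ⟨0, default⟩
  obtain ⟨G, hG⟩ := IsoClass.exists_pPart_eq f <| (Set.finite_range h).subset fun p hp => by
    by_contra hr
    exact hp (Function.extend_apply' _ _ _ hr)
  refine ⟨G, ?_⟩
  simp only [hG]
  refine Set.Subset.antisymm ?_ ?_
  · rintro _ ⟨p, rfl⟩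
    by_cases hp : ∃ t, h t = p
    · obtain ⟨t, rfl⟩ := hp
      simp only [f, hh.extend_apply, Subtype.coe_prop]
    · simp only [f, Function.extend_apply' _ _ _ hp, h0]
  · intro t ht
    exact ⟨h ⟨t, ht⟩, hh.extend_apply _ _ _⟩

/-! ### Estimates for the local measures, uniform in p -/

theorem localWeight_apply (p : Nat.Primes) (S : Set IntPartition) :
    localWeight p S = ∑' l : IntPartition,
      S.indicator (fun l => (Nat.card (AddAut (PartitionGroup p l)) : ℝ≥0∞)⁻¹) l := by
  classical
  rw [localWeight, Measure.sum_apply _ MeasurableSpace.measurableSet_top]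
  refine tsum_congr fun l => ?_
  rw [Measure.smul_apply, Measure.dirac_apply' _ MeasurableSpace.measurableSet_top, smul_eq_mul]
  by_cases h : l ∈ S <;> simp [h]

theorem inv_card_addAut_le (p : Nat.Primes) (l : IntPartition) :
    (Nat.card (AddAut (PartitionGroup p l)) : ℝ≥0∞)⁻¹ ≤ 2 * (((p : ℕ) : ℝ≥0∞)⁻¹) ^ l.1 := by
  have h : ((p : ℕ) : ℝ≥0∞) ^ l.1 ≤ 2 * Nat.card (AddAut (PartitionGroup p l)) := by
    exact_mod_cast PartitionGroup.card_le_two_mul_card_addAut p l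
  rw [← ENNReal.inv_pow]
  calc (Nat.card (AddAut (PartitionGroup p l)) : ℝ≥0∞)⁻¹
      = 2 * (2 * (Nat.card (AddAut (PartitionGroup p l)) : ℝ≥0∞))⁻¹ := by
        rw [ENNReal.mul_inv (by simp) (by simp), ← mul_assoc,
          ENNReal.mul_inv_cancel (by simp) (by simp), one_mul]
    _ ≤ 2 * (((p : ℕ) : ℝ≥0∞) ^ l.1)⁻¹ := by gcongr

/-- Keep `k` factors `p⁻¹` and bound the others by `2⁻¹`. The case `k = 0` bounds the total weight;
`k = 2` gives a tail summable over the primes. -/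
theorem localWeight_setOf_le (p : Nat.Primes) (k : ℕ) :
    localWeight p {l | k ≤ l.1} ≤
      2 * 2 ^ k * (((p : ℕ) : ℝ≥0∞)⁻¹) ^ k * ∑' l : IntPartition, (2⁻¹ : ℝ≥0∞) ^ l.1 := by
  rw [localWeight_apply, ← ENNReal.tsum_mul_left]
  refine ENNReal.tsum_le_tsum fun l => ?_
  by_cases h : k ≤ l.1
  · rw [Set.indicator_of_mem (by exact h)]
    refine (inv_card_addAut_le p l).trans ?_
    obtain ⟨m, hm⟩ := Nat.exists_eq_add_of_le h
    have h2 : (2 : ℝ≥0∞) ^ k * 2⁻¹ ^ k = 1 := by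
      rw [← mul_pow, ENNReal.mul_inv_cancel (by simp) (by simp), one_pow]
    have hp : ((p : ℕ) : ℝ≥0∞)⁻¹ ≤ 2⁻¹ := ENNReal.inv_le_inv.2 (by exact_mod_cast p.2.two_le)
    calc 2 * (((p : ℕ) : ℝ≥0∞)⁻¹) ^ l.1
        = 2 * (2 ^ k * 2⁻¹ ^ k) * (((p : ℕ) : ℝ≥0∞)⁻¹ ^ k * ((p : ℕ) : ℝ≥0∞)⁻¹ ^ m) := by
          rw [h2, mul_one, hm, pow_add]
      _ ≤ 2 * (2 ^ k * 2⁻¹ ^ k) * (((p : ℕ) : ℝ≥0∞)⁻¹ ^ k * 2⁻¹ ^ m) := by gcongr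
      _ = _ := by rw [hm, pow_add]; ring
  · rw [Set.indicator_of_notMem (by exact h)]
    exact zero_le

theorem one_le_localWeight_singleton (p : Nat.Primes) :
    1 ≤ localWeight p {⟨0, default⟩} := by
  rw [localWeight_apply]
  refine le_trans ?_ (ENNReal.le_tsum (⟨0, default⟩ : IntPartition))
  rw [Set.indicator_of_mem (Set.mem_singleton _)]
  have : IsEmpty (Multiset.ToType (default : Nat.Partition 0).parts) := by
    rw [← Fintype.card_eq_zero_iff, Multiset.card_coe]
    simp
  have : Subsingleton (AddAut (PartitionGroup p ⟨0, default⟩)) :=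
    ⟨fun f g => AddEquiv.ext fun x => Subsingleton.elim _ _⟩
  rw [Nat.card_unique]
  simp

theorem localWeight_univ_ne_top (p : Nat.Primes) : localWeight p Set.univ ≠ ∞ := by
  have h := localWeight_setOf_le p 0
  simp only [Nat.zero_le, Set.ofPred_true, pow_zero, mul_one] at h
  exact ne_top_of_le_ne_top
    (ENNReal.mul_ne_top (by simp) IntPartition.tsum_two_inv_pow_ne_top) h

theorem one_le_localWeight_univ (p : Nat.Primes) : 1 ≤ localWeight p Set.univ :=
  (one_le_localWeight_singleton p).trans (measure_mono (Set.subset_univ _))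

instance localProb.isProbabilityMeasure (p : Nat.Primes) : IsProbabilityMeasure (localProb p) :=
  ⟨by
    rw [localProb, Measure.smul_apply, smul_eq_mul]
    exact ENNReal.inv_mul_cancel (one_pos.trans_le (one_le_localWeight_univ p)).ne'
      (localWeight_univ_ne_top p)⟩

theorem localProb_le_localWeight (p : Nat.Primes) (S : Set IntPartition) :
    localProb p S ≤ localWeight p S := by
  rw [localProb, Measure.smul_apply, smul_eq_mul]
  exact mul_le_of_le_one_left' (ENNReal.inv_le_one.2 (one_le_localWeight_univ p))

theorem tsum_localProb_two_le_ne_top : ∑' p : Nat.Primes, localProb p {l | 2 ≤ l.1} ≠ ∞ := by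
  have h : ∀ p : Nat.Primes, localProb p {l | 2 ≤ l.1} ≤
      (2 * 2 ^ 2 * ∑' l : IntPartition, (2⁻¹ : ℝ≥0∞) ^ l.1) *
        ENNReal.ofReal (((p : ℕ) : ℝ) ^ 2)⁻¹ := by
    intro p
    refine (localProb_le_localWeight p _).trans ((localWeight_setOf_le p 2).trans_eq ?_)
    have hp : (0 : ℝ) < ((p : ℕ) : ℝ) ^ 2 := pow_pos (by exact_mod_cast p.2.pos) 2
    rw [ENNReal.ofReal_inv_of_pos hp, ENNReal.ofReal_pow (by positivity), ENNReal.ofReal_natCast,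
      ← ENNReal.inv_pow]
    ring
  refine ne_top_of_le_ne_top ?_ (ENNReal.tsum_le_tsum h)
  rw [ENNReal.tsum_mul_left]
  refine ENNReal.mul_ne_top
    (ENNReal.mul_ne_top (by norm_num [ENNReal.mul_eq_top]) IntPartition.tsum_two_inv_pow_ne_top) ?_
  exact ((Real.summable_nat_pow_inv.2 one_lt_two).comp_injective
    (Subtype.val_injective (p := Nat.Prime))).tsum_ofReal_ne_top

/-- The trivial group has local probability bounded below independently of the prime. -/
theorem exists_localProb_compl_le :
    ∃ r : ℝ≥0∞, r < 1 ∧ ∀ p : Nat.Primes, localProb p {⟨0, default⟩}ᶜ ≤ r := by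
  set K : ℝ≥0∞ := 2 * ∑' l : IntPartition, (2⁻¹ : ℝ≥0∞) ^ l.1 with hK
  have hKtop : K ≠ ∞ := ENNReal.mul_ne_top (by simp) IntPartition.tsum_two_inv_pow_ne_top
  -- `K` bounds every total weight and the trivial group has weight at least 1, so its probability
  -- is at least `K⁻¹`.
  refine ⟨1 - K⁻¹, ENNReal.sub_lt_self (by simp) (by simp) (ENNReal.inv_ne_zero.2 hKtop), ?_⟩
  intro p
  rw [prob_compl_eq_one_sub MeasurableSpace.measurableSet_top]
  refine tsub_le_tsub_left ?_ _
  have h := localWeight_setOf_le p 0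
  simp only [Nat.zero_le, Set.ofPred_true, pow_zero, mul_one, ← hK] at h
  rw [localProb, Measure.smul_apply, smul_eq_mul]
  calc K⁻¹ ≤ (localWeight p Set.univ)⁻¹ := ENNReal.inv_le_inv.2 h
    _ ≤ _ := le_mul_of_one_le_right' (one_le_localWeight_singleton p)

/-! ### The product measure and its typical families -/

/-- The joint law of independent partitions, one for each prime. -/
noncomputable def primesProb : Measure (Nat.Primes → IntPartition) :=
  Measure.infinitePi localProb

instance primesProb.isProbabilityMeasure : IsProbabilityMeasure primesProb := by
  unfold primesProb
  infer_instance

theorem hasProd_primesProb (S : Set IntPartition) :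
    HasProd (fun p : Nat.Primes => localProb p S) (primesProb {ω | ∀ p, ω p ∈ S}) := by
  have h : {ω : Nat.Primes → IntPartition | ∀ p, ω p ∈ S} = Set.univ.pi fun _ => S := by
    ext ω
    simp
  rw [h, primesProb, Measure.infinitePi_pi_univ _ fun _ => MeasurableSpace.measurableSet_top]
  exact (ENNReal.multipliable_of_le_one fun p => prob_le_one).hasProd

theorem ae_exists_eq_empty : ∀ᵐ ω ∂primesProb, ∃ p, ω p = ⟨0, default⟩ := by
  obtain ⟨r, hr, h⟩ := exists_localProb_compl_le
  have h0 : primesProb {ω | ∀ p, ω p ∈ ({⟨0, default⟩}ᶜ : Set IntPartition)} = 0 := by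
    rw [← nonpos_iff_eq_zero,
      (hasProd_primesProb _).unique (ENNReal.hasProd_iInf_prod fun p => prob_le_one)]
    refine ge_of_tendsto' (ENNReal.tendsto_pow_atTop_nhds_zero_of_lt_one hr) fun n => ?_
    have : Infinite Nat.Primes := Nat.Primes.infinite
    obtain ⟨F, rfl⟩ := Infinite.exists_subset_card_eq Nat.Primes n
    exact (iInf_le _ F).trans (Finset.prod_le_pow_card F _ r fun p _ => h p)
  rw [ae_iff]
  convert h0 using 3 with ω
  simp

/-- Borel–Cantelli: almost surely only finitely many `ω p` have size at least 2, and only finitely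
many partitions are smaller. -/
theorem ae_finite_range : ∀ᵐ ω ∂primesProb, (Set.range ω).Finite := by
  have h : ∑' p : Nat.Primes, primesProb {ω | 2 ≤ (ω p).1} ≠ ∞ := by
    convert tsum_localProb_two_le_ne_top using 3 with p
    exact (measurePreserving_eval_infinitePi localProb p).measure_preimage
      (s := {l | 2 ≤ l.1}) MeasurableSpace.measurableSet_top.nullMeasurableSet
  filter_upwards [ae_finite_setOfPred_mem h] with ω hω
  have hsmall : {l : IntPartition | l.1 ≤ 1}.Finite := by
    refine ((Set.finite_Iic 1).biUnion fun n _ => Set.finite_range (Sigma.mk n)).subset ?_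
    rintro ⟨n, l⟩ hl
    exact Set.mem_biUnion (show n ∈ Set.Iic 1 from hl) ⟨l, rfl⟩
  refine (hsmall.union (hω.image ω)).subset ?_
  rintro _ ⟨p, rfl⟩
  by_cases hp : 2 ≤ (ω p).1
  · exact Or.inr ⟨p, hp, rfl⟩
  · exact Or.inl (show (ω p).1 ≤ 1 by omega)

/-- The families of partitions that take finitely many values, among them the empty partition. -/
def tameFamilies : Set (Nat.Primes → IntPartition) :=
  {ω | (Set.range ω).Finite ∧ ∃ p, ω p = ⟨0, default⟩}

theorem measurableSet_forall_mem (S : Set IntPartition) :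
    MeasurableSet {ω : Nat.Primes → IntPartition | ∀ p, ω p ∈ S} := by
  rw [Set.ofPred_forall]
  exact MeasurableSet.iInter fun p => measurable_pi_apply p MeasurableSpace.measurableSet_top

theorem measurableSet_tameFamilies : MeasurableSet tameFamilies := by
  refine MeasurableSet.inter ?_ ?_
  -- There are only countably many finite sets of partitions.
  · have h : {ω : Nat.Primes → IntPartition | (Set.range ω).Finite} =
        ⋃ T : Finset IntPartition, {ω | ∀ p, ω p ∈ (T : Set IntPartition)} := by
      ext ω
      simp only [Set.mem_ofPred_eq, Set.mem_iUnion]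
      constructor
      · intro h
        exact ⟨h.toFinset, fun p => by simp⟩
      · rintro ⟨T, hT⟩
        exact T.finite_toSet.subset (Set.range_subset_iff.2 hT)
    change MeasurableSet {ω : Nat.Primes → IntPartition | (Set.range ω).Finite}
    rw [h]
    exact MeasurableSet.iUnion fun T => measurableSet_forall_mem _
  · change MeasurableSet {ω : Nat.Primes → IntPartition | ∃ p, ω p = ⟨0, default⟩}
    rw [Set.ofPred_exists]
    exact MeasurableSet.iUnion fun p => measurable_pi_apply (X := fun _ => IntPartition) p
      (MeasurableSpace.measurableSet_top (s := {(⟨0, default⟩ : IntPartition)}))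

theorem ae_mem_tameFamilies : ∀ᵐ ω ∂primesProb, ω ∈ tameFamilies :=
  ae_finite_range.and ae_exists_eq_empty

/-! ### From families to groups, and the theorem -/

open Classical in
/-- A group whose set of `p`-parts is the set of values of the family `ω`, if there is one. -/
noncomputable def groupOfFamily (ω : Nat.Primes → IntPartition) : IsoClass :=
  if h : ω ∈ tameFamilies then
    (IsoClass.exists_range_pPart_eq h.1 (Set.mem_range.2 h.2)).choose
  else IsoClass.mk ⟨PUnit⟩

theorem IsGivenBy.groupOfFamily_iff {E : IsoClass → Prop} {e : IntPartition → Prop}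
    (h : IsGivenBy E e) {ω : Nat.Primes → IntPartition} (hω : ω ∈ tameFamilies) :
    E (groupOfFamily ω) ↔ ∀ p, e (ω p) := by
  have h1 := (IsoClass.exists_range_pPart_eq hω.1 (Set.mem_range.2 hω.2)).choose_spec
  rw [h, groupOfFamily, dif_pos hω, ← Set.forall_mem_range (p := e),
    ← Set.forall_mem_range (p := e), h1]

theorem measurable_groupOfFamily : Measurable groupOfFamily := by
  refine measurable_generateFrom ?_
  rintro _ ⟨E, ⟨e, he⟩, rfl⟩
  -- Off the tame families the map is constant, so the second piece is empty or the whole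
  -- complement.
  have h : groupOfFamily ⁻¹' {G | E G} = tameFamilies ∩ {ω | ∀ p, ω p ∈ {l | e l}} ∪
      tameFamiliesᶜ ∩ {_ω | E (IsoClass.mk ⟨PUnit⟩)} := by
    ext ω
    by_cases hω : ω ∈ tameFamilies
    · simp [hω, he.groupOfFamily_iff hω]
    · simp [hω, groupOfFamily]
  rw [h]
  exact (measurableSet_tameFamilies.inter (measurableSet_forall_mem _)).union
    (measurableSet_tameFamilies.compl.inter (MeasurableSet.const _))

theorem IsUniform.measurableSet {E : IsoClass → Prop} (hE : IsUniform E) :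
    MeasurableSet {G | E G} :=
  MeasurableSpace.measurableSet_generateFrom ⟨E, hE, rfl⟩

/-- The conjunction of two uniform properties is defined by the conjunction of their local
conditions. -/
theorem isPiSystem_uniform :
    IsPiSystem {S : Set IsoClass | ∃ E : IsoClass → Prop, IsUniform E ∧ S = {G | E G}} := by
  rintro _ ⟨E, ⟨e, he⟩, rfl⟩ _ ⟨F, ⟨f, hf⟩, rfl⟩ -
  refine ⟨fun G => E G ∧ F G, ⟨fun l => e l ∧ f l, fun G => ?_⟩, rfl⟩
  change E G ∧ F G ↔ _
  rw [he, hf, forall_and]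

theorem mainTheorem1 :
    (∀ E : IsoClass → Prop, IsUniform E → Measurable E) ∧
    ∃! P : Measure IsoClass, IsProbabilityMeasure P ∧
      ∀ (E : IsoClass → Prop) (e : IntPartition → Prop), IsGivenBy E e →
        HasProd (fun p : Nat.Primes => localProb p {l | e l}) (P {G | E G}) := by
  have hex : IsProbabilityMeasure (primesProb.map groupOfFamily) ∧
      ∀ (E : IsoClass → Prop) (e : IntPartition → Prop), IsGivenBy E e →
        HasProd (fun p : Nat.Primes => localProb p {l | e l})
          (primesProb.map groupOfFamily {G | E G}) := by
    refine ⟨Measure.isProbabilityMeasure_map measurable_groupOfFamily.aemeasurable,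
      fun E e he => ?_⟩
    rw [Measure.map_apply measurable_groupOfFamily (IsUniform.measurableSet ⟨e, he⟩)]
    have h : primesProb (groupOfFamily ⁻¹' {G | E G}) = primesProb {ω | ∀ p, ω p ∈ {l | e l}} := by
      refine measure_congr ?_
      filter_upwards [ae_mem_tameFamilies] with ω hω
      exact propext (he.groupOfFamily_iff hω)
    rw [h]
    exact hasProd_primesProb _
  refine ⟨fun E hE => measurableSet_setOfPred.1 hE.measurableSet,
    primesProb.map groupOfFamily, hex, ?_⟩
  rintro Q ⟨hQ, hQE⟩
  have hP := hex.1
  refine ext_of_generate_finite _ rfl isPiSystem_uniform ?_ ?_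
  · rintro _ ⟨E, ⟨e, he⟩, rfl⟩
    exact (hQE E e he).unique (hex.2 E e he)
  · rw [measure_univ, measure_univ]
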